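/- Let $\langle x\rangle=(1+x^2)^{1/2}$. For $\lambda\ge 1$ and integers $j,k\ge 0$ define, for points $(\xi,\tau)\in\mathbb R^2$, $$A_j=\{(\xi,\tau): 2^j\le\langle\xi\rangle<2^{j+1}\},\qquad B_k=\Big\{(\xi,\tau): 2^k\le\Big\langle\tau+\xi^3+\frac1{\lambda^4\xi}\Big\rangle<2^{k+1}\Big\},$$ and, for $f\in\mathscr S'(\mathbb R^2)$, $$\|f\|_{\hat X^{0,1/2,1}}=\Big(\sum_{j\ge0}\Big(\sum_{k\ge0}\Big\|\Big\langle\tau+\xi^3+\frac1{\lambda^4\xi}\Big\rangle^{1/2}f\Big\|_{L^2(A_j\cap B_k)}\Big)^2\Big)^{1/2}\in[0,\infty],$$ the norm being $\infty$ if $f$ is not a function. **Lemma 2.2.** There is an absolute constant $C>0$ such that the following holds for all $\lambda\ge1$ and all $j\ge0$. Let $f\in\mathscr S'(\mathbb R^2)$ with $\operatorname{supp} f\subset\overline{A_j}$ (in particular, if $\operatorname{supp} f\subset A_j$), let $g\in\mathscr S(\mathbb R^2)$, let $\Omega\subset\mathbb R^2$ be a Lebesgue measurable set of positive measure, and let $$K_1=\inf\{|\xi_1+\xi|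 : \exists\,\tau,\tau_1\ \text{such that}\ (\xi,\tau)\in\Omega,\ (\xi_1,\tau_1)\in A_j\}.$$ Suppose that for all $(\xi,\tau)\in\Omega$ and $(\xi_1,\tau_1)\in\operatorname{supp} f$, with $\xi_2=\xi-\xi_1$, either $$\xi\xi_1<0,\qquad\text{or}\qquad \xi\xi_1\ge0\ \text{ and }\ \Big|1-\frac{4}{3\lambda^4\xi\xi_1\xi_2^2}\Big|>\frac12,$$ where the last inequality counts as satisfied when $\xi\xi_1\xi_2=0$. Then for every $k\ge0$ $$\|f*g\|_{L^2(B_k)}\le C\,2^{k/4}\,\|f\|_{\hat X^{0,1/2,1}}\,\big\||\xi|^{-1/4}g\big\|_{L^2(\mathbb R^2)},$$ $$\|f*g\|_{L^2(\Omega\cap B_k)}\le C\,2^{k/2}K_1^{-1/2}\,\|f\|_{\hat X^{0,1/2,1}}\,\big\||\xi|^{-1/2}g\big\|_{L^2(\mathbb R^2)},$$ in $[0,\infty]$, with $K_1^{-1/2}=\infty$ if $K_1=0$, and $0\cdot\infty=0$. -/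

import Mathlib

open MeasureTheory SchwartzMap
open scoped ENNReal

noncomputable section

namespace Ostrovsky

/-- The Japanese bracket `⟨x⟩ = (1 + x²)^{1/2}`. -/
def bracket (x : ℝ) : ℝ := Real.sqrt (1 + x ^ 2)

/-- The modulation `τ + ξ³ + 1/(λ⁴ ξ)` at the frequency point `p = (ξ, τ)`.
(It is undefined on the null line `ξ = 0`, where the formula below takes the value `τ`.) -/
def modulation (lam : ℝ) (p : ℝ × ℝ) : ℝ := p.2 + p.1 ^ 3 + 1 / (lam ^ 4 * p.1)

/-- The dyadic frequency region `A_j`, for points `(ξ, τ)`. -/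
def A (j : ℕ) : Set (ℝ × ℝ) :=
  {p | (2 : ℝ) ^ j ≤ bracket p.1 ∧ bracket p.1 < (2 : ℝ) ^ (j + 1)}

/-- The dyadic modulation region `B_k`, for points `(ξ, τ)`. -/
def B (lam : ℝ) (k : ℕ) : Set (ℝ × ℝ) :=
  {p | (2 : ℝ) ^ k ≤ bracket (modulation lam p) ∧
    bracket (modulation lam p) < (2 : ℝ) ^ (k + 1)}

/-- The `ℓ²_j(ℓ¹_k)` sum of the norms of `⟨ξ⟩^s ⟨τ + ξ³ + 1/(λ⁴ξ)⟩^b F` in `L²(A_j ∩ B_k)`,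
for a function `F` of `(ξ, τ)`. -/
def besovNorm (lam s b : ℝ) (F : ℝ × ℝ → ℂ) : ℝ≥0∞ :=
  (∑' j : ℕ, (∑' k : ℕ,
    eLpNorm (fun p => (bracket p.1 ^ s * bracket (modulation lam p) ^ b) • F p) 2
      (volume.restrict (A j ∩ B lam k))) ^ 2) ^ (1 / 2 : ℝ)

/-- The tempered distribution `f` is given by integration against the function `F`. -/
def Represents (F : ℝ × ℝ → ℂ) (f : 𝓢'(ℝ × ℝ, ℂ)) : Prop :=
  ∀ φ : 𝓢(ℝ × ℝ, ℂ), Integrable (fun p => φ p * F p) ∧ f φ = ∫ p, φ p * F p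

/-- The norm of `X̂^{s,b,1}` on tempered distributions on the frequency side (that is, the
`X^{s,b,1}` norm of the inverse Fourier transform of `f`). A function representing `f` is unique up
to a null set, so the infimum is the value at any representative; it is `∞` if `f` is not a
function. -/
def hatNorm (lam s b : ℝ) (f : 𝓢'(ℝ × ℝ, ℂ)) : ℝ≥0∞ :=
  ⨅ (F : ℝ × ℝ → ℂ) (_ : Represents F f), besovNorm lam s b F

/-- The Schwartz function `y ↦ g (x - y)`. -/
def reflectAt (g : 𝓢(ℝ × ℝ, ℂ)) (x : ℝ × ℝ) : 𝓢(ℝ × ℝ, ℂ) :=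
  SchwartzMap.compSubConstCLM ℂ x
    (SchwartzMap.compCLMOfContinuousLinearEquiv ℂ (ContinuousLinearEquiv.neg ℝ) g)

theorem reflectAt_apply (g : 𝓢(ℝ × ℝ, ℂ)) (x y : ℝ × ℝ) : reflectAt g x y = g (x - y) := by
  simp [reflectAt]

/-- The convolution `f ∗ g` of a tempered distribution and a Schwartz function, as the function
`x ↦ ⟨f, g (x - ·)⟩`. -/
def conv (f : 𝓢'(ℝ × ℝ, ℂ)) (g : 𝓢(ℝ × ℝ, ℂ)) (x : ℝ × ℝ) : ℂ := f (reflectAt g x)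

/-- The norm of `|ξ|^a g` in `L²(ℝ²)`. -/
def weightedL2 (a : ℝ) (g : 𝓢(ℝ × ℝ, ℂ)) : ℝ≥0∞ :=
  eLpNorm (fun p => (|p.1| ^ a) • g p) 2 volume

/-- `K₁ = inf {|ξ₁ + ξ| : ∃ τ τ₁, (ξ, τ) ∈ Ω, (ξ₁, τ₁) ∈ A_j}`. -/
def K₁ (Ω : Set (ℝ × ℝ)) (j : ℕ) : ℝ :=
  sInf {r | ∃ ξ ξ₁ τ τ₁ : ℝ, (ξ, τ) ∈ Ω ∧ (ξ₁, τ₁) ∈ A j ∧ r = |ξ₁ + ξ|}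

end Ostrovsky

end

namespace Ostrovsky

/-! By duality and two applications of Cauchy–Schwarz, both bounds reduce to the measure of the
interaction set of those `y ∈ A j ∩ B lam i` with `y + z ∈ Q`, where `z = (s, t)` is a fixed point
of the domain of `g` and `Q` lies in `B lam k`.

Write `u = ξ₁ (ξ₁ + s)` and `c = λ⁻⁴`. The modulations at `y + z` and at `y` differ by `t + s³ + s
(3u - c/u)`, and `3u - c/u` increases with slope at least 3 on each of the half-lines `u < 0` and `u
> 0`. Bounded modulations therefore confine `u`, on each half-line, to an interval of length
`O(M/|s|)`, where `M = max (2^i) (2^k)`. Since `u(x) - u(y) = (x - y)(x + y + s)`, a further cut at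
the vertex `ξ₁ = -s/2` confines `ξ₁` to length `O((M/|s|)^{1/2})`, and also to length `O(M/(|s|
K₁))` because `|2ξ₁ + s| ≥ K₁`. For fixed `ξ₁`, the variable `τ₁` ranges over a set of diameter
`O(min (2^i) (2^k))`.

The products are at most a constant times `2^{k/2} 2^i |s|^{-1/2}` and `2^k 2^i |s|⁻¹ K₁⁻¹`. After a
square root, the power of `|s|` becomes the weight on `g`, and `2^{i/2}` is the modulation weight of
`f`, whose `ℓ¹` sum over `i` is what the triangle inequality requires. -/

/-! ### Duality and Cauchy–Schwarz for convolutions -/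

/-- The convolution of two nonnegative functions. -/
noncomputable def lconv (f g : ℝ × ℝ → ℝ≥0∞) (x : ℝ × ℝ) : ℝ≥0∞ := ∫⁻ y, f y * g (x - y)

theorem measurable_lconv {f g : ℝ × ℝ → ℝ≥0∞} (hf : Measurable f) (hg : Measurable g) :
    Measurable (lconv f g) := by
  unfold lconv
  apply Measurable.lintegral_prod_right'
    (f := fun z : (ℝ × ℝ) × (ℝ × ℝ) => f z.2 * g (z.1 - z.2))
  fun_prop

theorem lintegral_mul_le_sqrt (f g : ℝ × ℝ → ℝ≥0∞) (hf : AEMeasurable f) (hg : AEMeasurable g) :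
    ∫⁻ x, f x * g x ≤
      (∫⁻ x, f x ^ 2) ^ (1 / 2 : ℝ) * (∫⁻ x, g x ^ 2) ^ (1 / 2 : ℝ) := by
  have := ENNReal.lintegral_mul_le_Lp_mul_Lq volume Real.HolderConjugate.two_two hf hg
  simpa using this

theorem lintegral_mul_lconv {f g h : ℝ × ℝ → ℝ≥0∞} (hf : Measurable f) (hg : Measurable g)
    (hh : Measurable h) :
    ∫⁻ x, h x * lconv f g x = ∫⁻ z, g z * ∫⁻ y, f y * h (y + z) := by
  calc ∫⁻ x, h x * lconv f g x = ∫⁻ x, ∫⁻ y, h x * (f y * g (x - y)) := by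
        refine lintegral_congr fun x => ?_
        rw [lconv, lintegral_const_mul]
        fun_prop
    _ = ∫⁻ y, ∫⁻ x, h x * (f y * g (x - y)) := by
        apply lintegral_lintegral_swap
        fun_prop
    _ = ∫⁻ y, ∫⁻ z, h (y + z) * (f y * g z) := by
        refine lintegral_congr fun y => ?_
        rw [← lintegral_add_left_eq_self _ y]
        simp
    _ = ∫⁻ z, ∫⁻ y, h (y + z) * (f y * g z) := by
        apply lintegral_lintegral_swap
        fun_prop
    _ = _ := by
        refine lintegral_congr fun z => ?_
        rw [← lintegral_const_mul]
        · exact lintegral_congr fun y => by ring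
        · fun_prop

/-- A trilinear Cauchy–Schwarz estimate: if `f` lives on `P`, `h` lives on `Q`, and the translates
`Q - z` meet `P` in measure at most `D / w(z)²`, the form is bounded with constant `D^{1/2}`. -/
theorem lintegral_trilinear_le {f G w h : ℝ × ℝ → ℝ≥0∞} {P Q : Set (ℝ × ℝ)} {D : ℝ≥0∞}
    (hf : Measurable f) (hG : Measurable G) (hw : Measurable w) (hh : Measurable h)
    (hP : MeasurableSet P) (hQ : MeasurableSet Q)
    (hfP : ∀ x ∉ P, f x = 0) (hhQ : ∀ x ∉ Q, h x = 0)
    (hD : ∀ z, w z ^ 2 * volume {y | y ∈ P ∧ y + z ∈ Q} ≤ D) :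
    ∫⁻ z, (w z * G z) * ∫⁻ y, f y * h (y + z) ≤
      D ^ (1 / 2 : ℝ) * (∫⁻ x, f x ^ 2) ^ (1 / 2 : ℝ) * (∫⁻ x, G x ^ 2) ^ (1 / 2 : ℝ) *
        (∫⁻ x, h x ^ 2) ^ (1 / 2 : ℝ) := by
  have hI : Measurable fun z => ∫⁻ y, f y * h (y + z) := by
    apply Measurable.lintegral_prod_right'
      (f := fun z : (ℝ × ℝ) × (ℝ × ℝ) => f z.2 * h (z.2 + z.1))
    fun_prop
  have hsq : ∀ z, (∫⁻ y, f y * h (y + z)) ^ 2 ≤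
      volume {y | y ∈ P ∧ y + z ∈ Q} * ∫⁻ y, f y ^ 2 * h (y + z) ^ 2 := by
    intro z
    have hE : MeasurableSet {y | y ∈ P ∧ y + z ∈ Q} :=
      hP.inter ((measurable_id.add_const z) hQ)
    -- The integrand lives on the interaction set; inserting its indicator lets Cauchy–Schwarz
    -- produce the measure of that set.
    have h1 : ∫⁻ y, f y * h (y + z) =
        ∫⁻ y, ({y | y ∈ P ∧ y + z ∈ Q}.indicator 1 y) * (f y * h (y + z)) := by
      refine lintegral_congr fun y => ?_
      by_cases hy : y ∈ {y | y ∈ P ∧ y + z ∈ Q}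
      · simp [Set.indicator_of_mem hy]
      · rw [Set.indicator_of_notMem hy]
        by_cases hyP : y ∈ P
        · rw [hhQ _ fun hq => hy ⟨hyP, hq⟩]; simp
        · rw [hfP _ hyP]; simp
    have h2 := lintegral_mul_le_sqrt ({y | y ∈ P ∧ y + z ∈ Q}.indicator 1)
      (fun y => f y * h (y + z)) (measurable_one.indicator hE).aemeasurable
      (by fun_prop)
    have h3 : ∫⁻ y, ({y | y ∈ P ∧ y + z ∈ Q}.indicator (1 : ℝ × ℝ → ℝ≥0∞) y) ^ 2 =
        volume {y | y ∈ P ∧ y + z ∈ Q} := by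
      rw [← lintegral_indicator_one hE]
      refine lintegral_congr fun y => ?_
      by_cases hy : y ∈ {y | y ∈ P ∧ y + z ∈ Q}
      · simp [Set.indicator_of_mem hy]
      · simp [Set.indicator_of_notMem hy]
    rw [h1]
    calc _ ≤ _ := pow_le_pow_left' h2 2
      _ = _ := by
        rw [mul_pow, ← ENNReal.rpow_natCast, ← ENNReal.rpow_natCast, ← ENNReal.rpow_mul,
          ← ENNReal.rpow_mul, h3]
        simp [mul_pow]
  calc ∫⁻ z, (w z * G z) * ∫⁻ y, f y * h (y + z)
      = ∫⁻ z, G z * (w z * ∫⁻ y, f y * h (y + z)) := lintegral_congr fun z => by ring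
    _ ≤ (∫⁻ x, G x ^ 2) ^ (1 / 2 : ℝ) *
        (∫⁻ z, (w z * ∫⁻ y, f y * h (y + z)) ^ 2) ^ (1 / 2 : ℝ) :=
      lintegral_mul_le_sqrt _ _ hG.aemeasurable (hw.mul hI).aemeasurable
    _ ≤ (∫⁻ x, G x ^ 2) ^ (1 / 2 : ℝ) *
        (D * ((∫⁻ x, f x ^ 2) * ∫⁻ x, h x ^ 2)) ^ (1 / 2 : ℝ) := by
      gcongr
      calc ∫⁻ z, (w z * ∫⁻ y, f y * h (y + z)) ^ 2
          ≤ ∫⁻ z, D * ∫⁻ y, f y ^ 2 * h (y + z) ^ 2 := by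
            refine lintegral_mono fun z => ?_
            rw [mul_pow]
            calc _ ≤ _ := mul_le_mul_right (hsq z) _
              _ = _ := (mul_assoc _ _ _).symm
              _ ≤ _ := mul_le_mul_left (hD z) _
        _ = D * ∫⁻ z, ∫⁻ y, f y ^ 2 * h (y + z) ^ 2 := by
            rw [lintegral_const_mul]
            apply Measurable.lintegral_prod_right'
              (f := fun z : (ℝ × ℝ) × (ℝ × ℝ) => f z.2 ^ 2 * h (z.2 + z.1) ^ 2)
            fun_prop
        _ = D * ∫⁻ y, ∫⁻ z, f y ^ 2 * h (y + z) ^ 2 := by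
            congr 1
            apply lintegral_lintegral_swap
            fun_prop
        _ = D * ∫⁻ y, f y ^ 2 * ∫⁻ z, h z ^ 2 := by
            congr 1
            refine lintegral_congr fun y => ?_
            rw [lintegral_const_mul _ (by fun_prop),
              lintegral_add_left_eq_self (fun z => h z ^ 2) y]
        _ = _ := by rw [lintegral_mul_const _ (by fun_prop)]
    _ = _ := by
      rw [ENNReal.mul_rpow_of_nonneg _ _ (by norm_num), ENNReal.mul_rpow_of_nonneg _ _ (by norm_num)]
      ring

/-- The `L²` norm over a set is controlled by testing against bounded functions supported there. -/
theorem sqrt_setLIntegral_sq_le_of_forall_test {u : ℝ × ℝ → ℝ≥0∞} {Q : Set (ℝ × ℝ)} {c : ℝ≥0∞}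
    (hu : Measurable u) (hQ : MeasurableSet Q)
    (H : ∀ h : ℝ × ℝ → ℝ≥0∞, Measurable h → (∀ x ∉ Q, h x = 0) →
      ∫⁻ x, h x * u x ≤ c * (∫⁻ x, h x ^ 2) ^ (1 / 2 : ℝ)) :
    (∫⁻ x in Q, u x ^ 2) ^ (1 / 2 : ℝ) ≤ c := by
  -- The natural test function is `u` itself on `Q`. Truncating in height and in space makes its
  -- square integral `I` finite, so that `I ≤ c I^{1/2}` can be divided by `I^{1/2}`; monotone
  -- convergence then removes the truncation.
  let T : ℕ → Set (ℝ × ℝ) := fun n => Q ∩ Metric.closedBall 0 n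
  let h : ℕ → ℝ × ℝ → ℝ≥0∞ := fun n => (T n).indicator fun x => min (u x) n
  have hT : ∀ n, MeasurableSet (T n) := fun n => hQ.inter measurableSet_closedBall
  have hm : ∀ n, Measurable (h n) := fun n => (hu.min measurable_const).indicator (hT n)
  have hmono : Monotone h := by
    intro m n hmn x
    simp only [h]
    have hsub : T m ⊆ T n :=
      Set.inter_subset_inter_right _ (Metric.closedBall_subset_closedBall (by exact_mod_cast hmn))
    refine (Set.indicator_le_indicator_of_subset hsub (fun _ => zero_le) x).trans ?_
    refine Set.indicator_le_indicator ?_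
    exact min_le_min le_rfl (by exact_mod_cast hmn)
  have hsup : ∀ x, ⨆ n, h n x ^ 2 = Q.indicator (fun x => u x ^ 2) x := by
    intro x
    by_cases hx : x ∈ Q
    · rw [Set.indicator_of_mem hx]
      have hlim : Filter.Tendsto (fun n : ℕ => min (u x) (n : ℝ≥0∞)) Filter.atTop
          (nhds (min (u x) ⊤)) := tendsto_const_nhds.min ENNReal.tendsto_nat_nhds_top
      have hlim2 : Filter.Tendsto (fun n => h n x) Filter.atTop (nhds (u x)) := by
        rw [min_top_right] at hlim
        refine hlim.congr' ?_
        obtain ⟨N, hN⟩ := exists_nat_ge (dist x 0)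
        filter_upwards [Filter.eventually_ge_atTop N] with n hn
        simp only [h]
        rw [Set.indicator_of_mem]
        exact ⟨hx, Metric.mem_closedBall.2 (hN.trans (by exact_mod_cast hn))⟩
      refine tendsto_nhds_unique (tendsto_atTop_iSup fun m n hmn => ?_)
        (((ENNReal.continuous_pow 2).tendsto _).comp hlim2)
      exact pow_le_pow_left' (hmono hmn x) 2
    · rw [Set.indicator_of_notMem hx]
      simp [h, T, hx]
  have hbound : ∀ n, ∫⁻ x, h n x ^ 2 ≤ c ^ 2 := by
    intro n
    set I := ∫⁻ x, h n x ^ 2 with hI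
    have hfin : I ≠ ⊤ := by
      refine ne_top_of_le_ne_top ?_ (lintegral_mono (g := (T n).indicator fun _ => (n : ℝ≥0∞) ^ 2) ?_)
      · rw [lintegral_indicator_const (hT n)]
        refine ENNReal.mul_ne_top (by simp) (ne_top_of_le_ne_top ?_ (measure_mono
          (Set.inter_subset_right : T n ⊆ Metric.closedBall 0 n)))
        exact measure_closedBall_lt_top.ne
      · intro x
        by_cases hx : x ∈ T n
        · simp only [h, Set.indicator_of_mem hx]
          exact pow_le_pow_left' (min_le_right _ _) 2
        · simp [h, Set.indicator_of_notMem hx]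
    have h1 : I ≤ c * I ^ (1 / 2 : ℝ) := by
      refine le_trans (lintegral_mono fun x => ?_) (H (h n) (hm n) ?_)
      · rw [sq]
        refine mul_le_mul_right ?_ _
        by_cases hx : x ∈ T n
        · simp only [h, Set.indicator_of_mem hx]; exact min_le_left _ _
        · simp [h, Set.indicator_of_notMem hx]
      · intro x hx
        simp only [h]
        rw [Set.indicator_of_notMem]
        exact fun hx' => hx hx'.1
    by_cases h0 : I = 0
    · rw [h0]; exact zero_le
    have hs0 : I ^ (1 / 2 : ℝ) ≠ 0 := by simp [ENNReal.rpow_eq_zero_iff, h0, hfin]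
    have hsT : I ^ (1 / 2 : ℝ) ≠ ⊤ := ENNReal.rpow_ne_top_of_nonneg (by norm_num) hfin
    have hIs : I = I ^ (1 / 2 : ℝ) * I ^ (1 / 2 : ℝ) := by
      rw [← ENNReal.rpow_add _ _ h0 hfin]; norm_num
    have h2 : I ^ (1 / 2 : ℝ) ≤ c := by
      rw [← ENNReal.mul_le_mul_iff_left hs0 hsT, ← hIs]
      exact h1
    rw [hIs, sq]
    gcongr
  have : ∫⁻ x in Q, u x ^ 2 ≤ c ^ 2 := by
    rw [← lintegral_indicator hQ]
    simp_rw [← hsup]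
    rw [lintegral_iSup (fun n => (hm n).pow_const 2)
      fun m n hmn x => pow_le_pow_left' (hmono hmn x) 2]
    exact iSup_le hbound
  calc _ ≤ (c ^ 2) ^ (1 / 2 : ℝ) := ENNReal.rpow_le_rpow this (by norm_num)
    _ = c := by rw [← ENNReal.rpow_natCast, ← ENNReal.rpow_mul]; norm_num

/-- The bilinear `L²` estimate for a function decomposed along measurable pieces `P i`. -/
theorem sqrt_setLIntegral_lconv_sq_le {f g G w : ℝ × ℝ → ℝ≥0∞} {P : ℕ → Set (ℝ × ℝ)}
    {Q : Set (ℝ × ℝ)} {D : ℕ → ℝ≥0∞}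
    (hf : Measurable f) (hg : Measurable g) (hG : Measurable G) (hw : Measurable w)
    (hP : ∀ i, MeasurableSet (P i)) (hQ : MeasurableSet Q)
    (hfP : ∀ᵐ x, f x ≤ ∑' i, (P i).indicator f x)
    (hgG : ∀ᵐ x, g x = w x * G x)
    (hD : ∀ i z, w z ^ 2 * volume {y | y ∈ P i ∧ y + z ∈ Q} ≤ D i) :
    (∫⁻ x in Q, lconv f g x ^ 2) ^ (1 / 2 : ℝ) ≤
      (∑' i, D i ^ (1 / 2 : ℝ) * (∫⁻ x in P i, f x ^ 2) ^ (1 / 2 : ℝ)) *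
        (∫⁻ x, G x ^ 2) ^ (1 / 2 : ℝ) := by
  refine sqrt_setLIntegral_sq_le_of_forall_test (measurable_lconv hf hg) hQ fun h hh hhQ => ?_
  have hm : ∀ i, Measurable ((P i).indicator f) := fun i => hf.indicator (hP i)
  rw [lintegral_mul_lconv hf hg hh]
  have hJ : ∀ i, Measurable fun z => ∫⁻ y, (P i).indicator f y * h (y + z) := by
    intro i
    have := hm i
    apply Measurable.lintegral_prod_right'
      (f := fun z : (ℝ × ℝ) × (ℝ × ℝ) => (P i).indicator f z.2 * h (z.2 + z.1))
    fun_prop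
  calc ∫⁻ z, g z * ∫⁻ y, f y * h (y + z)
      ≤ ∫⁻ z, ∑' i, (w z * G z) * ∫⁻ y, (P i).indicator f y * h (y + z) := by
        refine lintegral_mono_ae ?_
        filter_upwards [hgG] with z hz
        rw [ENNReal.tsum_mul_left, ← lintegral_tsum fun i => by have := hm i; fun_prop, hz]
        refine mul_le_mul_right (lintegral_mono_ae ?_) _
        filter_upwards [hfP] with y hy
        rw [ENNReal.tsum_mul_right]
        exact mul_le_mul_left hy _
    _ = ∑' i, ∫⁻ z, (w z * G z) * ∫⁻ y, (P i).indicator f y * h (y + z) :=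
        lintegral_tsum fun i => ((hw.mul hG).mul (hJ i)).aemeasurable
    _ ≤ ∑' i, D i ^ (1 / 2 : ℝ) * (∫⁻ x in P i, f x ^ 2) ^ (1 / 2 : ℝ) *
          (∫⁻ x, G x ^ 2) ^ (1 / 2 : ℝ) * (∫⁻ x, h x ^ 2) ^ (1 / 2 : ℝ) := by
        refine ENNReal.tsum_le_tsum fun i => ?_
        refine (lintegral_trilinear_le (hm i) hG hw hh (hP i) hQ
          (fun x hx => Set.indicator_of_notMem hx f) hhQ (hD i)).trans_eq ?_
        congr 4
        rw [← lintegral_indicator (hP i)]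
        refine lintegral_congr fun x => ?_
        by_cases hx : x ∈ P i <;> simp [hx]
    _ = _ := by rw [ENNReal.tsum_mul_right, ENNReal.tsum_mul_right]

/-! ### The dyadic regions -/

theorem measurable_bracket : Measurable bracket := by
  unfold bracket; fun_prop

theorem measurable_modulation (lam : ℝ) : Measurable (modulation lam) := by
  unfold modulation; fun_prop

theorem measurableSet_A (j : ℕ) : MeasurableSet (A j) := by
  have h : Measurable fun p : ℝ × ℝ => bracket p.1 := measurable_bracket.comp measurable_fst
  exact (measurableSet_le measurable_const h).inter (measurableSet_lt h measurable_const)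

theorem measurableSet_B (lam : ℝ) (k : ℕ) : MeasurableSet (B lam k) := by
  have h : Measurable fun p => bracket (modulation lam p) :=
    measurable_bracket.comp (measurable_modulation lam)
  exact (measurableSet_le measurable_const h).inter (measurableSet_lt h measurable_const)

theorem abs_le_bracket (x : ℝ) : |x| ≤ bracket x :=
  Real.abs_le_sqrt (by linarith)

theorem one_le_bracket (x : ℝ) : 1 ≤ bracket x :=
  Real.one_le_sqrt.2 (by nlinarith [sq_nonneg x])

theorem abs_modulation_lt_of_mem_B {lam : ℝ} {k : ℕ} {p : ℝ × ℝ} (hp : p ∈ B lam k) :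
    |modulation lam p| < 2 * 2 ^ k := by
  rw [← pow_succ']
  exact (abs_le_bracket _).trans_lt hp.2

/-! ### Resonance function and interaction sets -/

/-- The resonance function depends on `ξ₁` only through `u = ξ₁ (ξ₁ + ξ₂)`. -/
theorem modulation_add_sub (lam : ℝ) {x s τ t : ℝ} (hx : x ≠ 0) (hxs : x + s ≠ 0) :
    modulation lam ((x, τ) + (s, t)) - modulation lam (x, τ) =
      t + s ^ 3 + s * (3 * (x * (x + s)) - (lam ^ 4)⁻¹ / (x * (x + s))) := by
  simp only [modulation, Prod.mk_add_mk, one_div, mul_inv]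
  field_simp
  ring

/-- The difference quotient of `3u - c/u` is `3 + c/(uv)`, and its second term is nonnegative when
`u` and `v` have the same sign. -/
theorem three_mul_abs_sub_le {c u v : ℝ} (hc : 0 ≤ c) (huv : 0 < u * v) :
    3 * |u - v| ≤ |(3 * u - c / u) - (3 * v - c / v)| := by
  have hu : u ≠ 0 := left_ne_zero_of_mul huv.ne'
  have hv : v ≠ 0 := right_ne_zero_of_mul huv.ne'
  have h : (3 * u - c / u) - (3 * v - c / v) = (3 + c / (u * v)) * (u - v) := by
    field_simp
    ring
  have h3 : 0 ≤ c / (u * v) := by positivity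
  rw [h, abs_mul, abs_of_nonneg (by linarith : 0 ≤ 3 + c / (u * v))]
  exact mul_le_mul_of_nonneg_right (by linarith) (abs_nonneg _)

/-- Two frequencies interacting with `(s, t)` within modulations `2a`, `2b`, in the same
monotonicity region, are close to each other. -/
theorem abs_sub_mul_abs_add_le {lam a b s t x y τ τ' : ℝ}
    (hx : x ≠ 0) (hxs : x + s ≠ 0) (hy : y ≠ 0) (hys : y + s ≠ 0)
    (hu : 0 < x * (x + s) ↔ 0 < y * (y + s))
    (hx1 : |modulation lam (x, τ)| < 2 * b) (hx2 : |modulation lam ((x, τ) + (s, t))| < 2 * a)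
    (hy1 : |modulation lam (y, τ')| < 2 * b) (hy2 : |modulation lam ((y, τ') + (s, t))| < 2 * a) :
    3 * |s| * (|x - y| * |x + y + s|) ≤ 8 * max a b := by
  have hux : x * (x + s) ≠ 0 := mul_ne_zero hx hxs
  have huy : y * (y + s) ≠ 0 := mul_ne_zero hy hys
  have huv : 0 < x * (x + s) * (y * (y + s)) := by
    rcases hux.lt_or_gt with h | h
    · have : y * (y + s) < 0 := lt_of_le_of_ne (not_lt.1 fun h' => absurd (hu.2 h') h.not_gt) huy
      exact mul_pos_of_neg_of_neg h this
    · exact mul_pos h (hu.1 h)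
  have key := three_mul_abs_sub_le (c := (lam ^ 4)⁻¹) (by positivity) huv
  have ex := modulation_add_sub lam (τ := τ) (t := t) hx hxs
  have ey := modulation_add_sub lam (τ := τ') (t := t) hy hys
  set p := 3 * (x * (x + s)) - (lam ^ 4)⁻¹ / (x * (x + s))
  set q := 3 * (y * (y + s)) - (lam ^ 4)⁻¹ / (y * (y + s))
  -- Subtracting the two resonance identities cancels `t + s³` and leaves four modulations, of total
  -- size at most `4a + 4b`.
  have hd : |s * (p - q)| ≤ 8 * max a b := by
    have ha := le_max_left a b
    have hb := le_max_right a b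
    rw [abs_lt] at hx1 hx2 hy1 hy2
    rw [abs_le]
    constructor <;> nlinarith
  calc 3 * |s| * (|x - y| * |x + y + s|) = |s| * (3 * |x * (x + s) - y * (y + s)|) := by
        rw [← abs_mul, show (x - y) * (x + y + s) = x * (x + s) - y * (y + s) by ring]
        ring
    _ ≤ |s| * |p - q| := by gcongr
    _ ≤ _ := by rwa [← abs_mul]

/-- A set of reals cut by two predicates into four classes of diameter at most `δ`. -/
theorem volume_le_four_mul {S : Set ℝ} (p q : ℝ → Prop) {δ : ℝ}
    (h : ∀ x ∈ S, ∀ y ∈ S, (p x ↔ p y) → (q x ↔ q y) → |x - y| ≤ δ) :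
    volume S ≤ 4 * ENNReal.ofReal δ := by
  have hcl : ∀ P Q : Prop, volume {x | x ∈ S ∧ (p x ↔ P) ∧ (q x ↔ Q)} ≤ ENNReal.ofReal δ := by
    intro P Q
    refine (Real.volume_le_diam _).trans (Metric.ediam_le fun x hx y hy => ?_)
    rw [edist_dist, Real.dist_eq]
    exact ENNReal.ofReal_le_ofReal
      (h x hx.1 y hy.1 (hx.2.1.trans hy.2.1.symm) (hx.2.2.trans hy.2.2.symm))
  have hsub : S ⊆ ({x | x ∈ S ∧ (p x ↔ True) ∧ (q x ↔ True)} ∪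
      {x | x ∈ S ∧ (p x ↔ True) ∧ (q x ↔ False)}) ∪
      ({x | x ∈ S ∧ (p x ↔ False) ∧ (q x ↔ True)} ∪
      {x | x ∈ S ∧ (p x ↔ False) ∧ (q x ↔ False)}) := by
    intro x hx
    by_cases hp : p x <;> by_cases hq : q x <;> simp [hx, hp, hq]
  calc volume S ≤ _ := measure_mono hsub
    _ ≤ (ENNReal.ofReal δ + ENNReal.ofReal δ) + (ENNReal.ofReal δ + ENNReal.ofReal δ) :=
      (measure_union_le _ _).trans (add_le_add
        ((measure_union_le _ _).trans (add_le_add (hcl _ _) (hcl _ _)))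
        ((measure_union_le _ _).trans (add_le_add (hcl _ _) (hcl _ _))))
    _ = _ := by ring

/-- The measure of the interaction set of `P` and `Q - (s, t)`, in terms of the diameter `δ` of its
frequency projection in each monotonicity region. -/
theorem volume_interaction_le {lam a b s t δ : ℝ} {P Q : Set (ℝ × ℝ)}
    (hP : MeasurableSet P) (hQ : MeasurableSet Q)
    (hPb : ∀ p ∈ P, |modulation lam p| < 2 * b) (hQa : ∀ p ∈ Q, |modulation lam p| < 2 * a)
    (hδ : ∀ x y τ τ' : ℝ, (x, τ) ∈ P → (x, τ) + (s, t) ∈ Q → (y, τ') ∈ P → (y, τ') + (s, t) ∈ Q →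
      3 * |s| * (|x - y| * |x + y + s|) ≤ 8 * max a b →
      |x - y| ≤ |x + y + s| → |x - y| ≤ δ) :
    volume {y | y ∈ P ∧ y + (s, t) ∈ Q} ≤
      ENNReal.ofReal (4 * min a b) * (4 * ENNReal.ofReal δ) := by
  set E := {y | y ∈ P ∧ y + (s, t) ∈ Q}
  have hE : MeasurableSet E := hP.inter ((measurable_id.add_const (s, t)) hQ)
  set S : Set ℝ := {x | x ≠ 0 ∧ x + s ≠ 0 ∧ ∃ τ, (x, τ) ∈ E}
  have hS : volume S ≤ 4 * ENNReal.ofReal δ := by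
    -- The first predicate fixes the half-line of `u`, the second the side of the vertex `-s/2`. On
    -- one side, `x + y + s` is the sum of `x + s/2` and `y + s/2`, which have the same sign, so it
    -- dominates their difference `x - y`.
    refine volume_le_four_mul (fun x => 0 < x * (x + s)) (fun x => 0 ≤ 2 * x + s) ?_
    rintro x ⟨hx, hxs, τ, hxP, hxQ⟩ y ⟨hy, hys, τ', hyP, hyQ⟩ hu hv
    refine hδ x y τ τ' hxP hxQ hyP hyQ (abs_sub_mul_abs_add_le hx hxs hy hys hu
      (hPb _ hxP) (hQa _ hxQ) (hPb _ hyP) (hQa _ hyQ)) ?_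
    by_cases h : 0 ≤ 2 * x + s
    · have h' := hv.1 h
      rw [abs_of_nonneg (by linarith : 0 ≤ x + y + s), abs_le]
      constructor <;> linarith
    · have h' : ¬ 0 ≤ 2 * y + s := fun h' => h (hv.2 h')
      rw [abs_of_nonpos (by linarith : x + y + s ≤ 0), abs_le]
      constructor <;> linarith
  -- For fixed `x`, both modulations are translates of `τ`, so the slice has diameter at most `4a`
  -- and at most `4b`.
  have hslice : ∀ x, volume (Prod.mk x ⁻¹' E) ≤ ENNReal.ofReal (4 * min a b) := by
    intro x
    refine (Real.volume_le_diam _).trans (Metric.ediam_le fun τ hτ τ' hτ' => ?_)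
    rw [edist_dist, Real.dist_eq]
    refine ENNReal.ofReal_le_ofReal ?_
    have h1 := abs_lt.1 (hPb _ hτ.1)
    have h2 := abs_lt.1 (hPb _ hτ'.1)
    have h3 := abs_lt.1 (hQa _ hτ.2)
    have h4 := abs_lt.1 (hQa _ hτ'.2)
    simp only [modulation, Prod.mk_add_mk] at h1 h2 h3 h4
    rw [abs_le]
    rcases min_cases a b with ⟨h, -⟩ | ⟨h, -⟩ <;> rw [h] <;> constructor <;> linarith
  -- Discards the frequencies where `1/ξ` takes its default value and the resonance identity fails.
  have hnull : ∀ᵐ x : ℝ, x ≠ 0 ∧ x + s ≠ 0 := by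
    have h1 : ∀ᵐ x : ℝ, x ≠ 0 := Measure.ae_ne volume 0
    have h2 : ∀ᵐ x : ℝ, x ≠ -s := Measure.ae_ne volume (-s)
    filter_upwards [h1, h2] with x hx hx'
    exact ⟨hx, fun h => hx' (by linarith)⟩
  rw [Measure.volume_eq_prod, Measure.prod_apply hE]
  calc ∫⁻ x, volume (Prod.mk x ⁻¹' E)
      ≤ ∫⁻ x, S.indicator (fun _ => ENNReal.ofReal (4 * min a b)) x := by
        refine lintegral_mono_ae ?_
        filter_upwards [hnull] with x hx
        by_cases hxS : x ∈ S
        · rw [Set.indicator_of_mem hxS]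
          exact hslice x
        · have : Prod.mk x ⁻¹' E = ∅ := by
            ext τ
            simp only [Set.mem_preimage, Set.mem_empty_iff_false, iff_false]
            exact fun h => hxS ⟨hx.1, hx.2, τ, h⟩
          simp [this]
    _ ≤ _ := lintegral_indicator_const_le _ _
    _ ≤ _ := by gcongr

/-- The interaction estimate behind the first bilinear bound. -/
theorem rpow_half_mul_volume_interaction_le {lam a b s t : ℝ} {P Q : Set (ℝ × ℝ)}
    (ha : 0 < a) (hb : 0 < b) (hP : MeasurableSet P) (hQ : MeasurableSet Q)
    (hPb : ∀ p ∈ P, |modulation lam p| < 2 * b) (hQa : ∀ p ∈ Q, |modulation lam p| < 2 * a) :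
    ENNReal.ofReal (Real.sqrt |s|) * volume {y | y ∈ P ∧ y + (s, t) ∈ Q} ≤
      ENNReal.ofReal (100 * Real.sqrt a * b) := by
  rcases eq_or_ne s 0 with rfl | hs
  · simp
  have hs' : 0 < |s| := abs_pos.2 hs
  have hm : 0 < max a b := lt_max_of_lt_left ha
  -- From `|x - y| ≤ |x + y + s|` one gets `3|s| |x - y|² ≤ 8 max a b`, and `8/3 ≤ 4 = 2²`.
  have hV := volume_interaction_le (s := s) (t := t) (δ := 2 * Real.sqrt (max a b) / Real.sqrt |s|)
    hP hQ hPb hQa (by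
      intro x y τ τ' _ _ _ _ h1 h2
      have e : 2 * √(max a b) / √|s| = √(4 * max a b / |s|) := by
        rw [Real.sqrt_div (by positivity), Real.sqrt_mul (by norm_num),
          show (4 : ℝ) = 2 ^ 2 by norm_num, Real.sqrt_sq (by norm_num)]
      rw [e]
      refine Real.abs_le_sqrt ?_
      rw [le_div_iff₀ hs', ← sq_abs]
      nlinarith [mul_le_mul_of_nonneg_left h2 (mul_nonneg hs'.le (abs_nonneg (x - y)))])
  have hmin : min a b * Real.sqrt (max a b) ≤ Real.sqrt a * b := by
    rcases le_total a b with h | h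
    · rw [min_eq_left h, max_eq_right h]
      calc a * √b = √a * (√a * √b) := by
            rw [← mul_assoc, Real.mul_self_sqrt ha.le]
        _ ≤ √a * (√b * √b) := by gcongr
        _ = _ := by rw [Real.mul_self_sqrt hb.le]
    · rw [min_eq_right h, max_eq_left h, mul_comm]
  have hmn : 0 < min a b := lt_min ha hb
  calc _ ≤ ENNReal.ofReal (Real.sqrt |s|) * (ENNReal.ofReal (4 * min a b) *
        (ENNReal.ofReal 4 * ENNReal.ofReal (2 * Real.sqrt (max a b) / Real.sqrt |s|))) := by
        gcongr
        simpa using hV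
    _ = ENNReal.ofReal (Real.sqrt |s| *
        (4 * min a b * (4 * (2 * Real.sqrt (max a b) / Real.sqrt |s|)))) := by
        rw [← ENNReal.ofReal_mul (by norm_num), ← ENNReal.ofReal_mul (by positivity),
          ← ENNReal.ofReal_mul (by positivity)]
    _ ≤ _ := by
        refine ENNReal.ofReal_le_ofReal ?_
        have : √|s| ≠ 0 := (Real.sqrt_pos.2 hs').ne'
        calc _ = 32 * (min a b * √(max a b)) := by field_simp; ring
          _ ≤ 32 * (√a * b) := by gcongr
          _ ≤ 100 * √a * b := by
            have : 0 ≤ √a * b := by positivity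
            linarith

/-- The interaction estimate behind the second bilinear bound. -/
theorem abs_mul_volume_interaction_le {lam a b s t K : ℝ} {P Q : Set (ℝ × ℝ)}
    (ha : 0 < a) (hb : 0 < b) (hK : 0 ≤ K) (hP : MeasurableSet P) (hQ : MeasurableSet Q)
    (hPb : ∀ p ∈ P, |modulation lam p| < 2 * b) (hQa : ∀ p ∈ Q, |modulation lam p| < 2 * a)
    (hPQ : ∀ p ∈ P, ∀ q ∈ Q, K ≤ |p.1 + q.1|) :
    ENNReal.ofReal |s| * volume {y | y ∈ P ∧ y + (s, t) ∈ Q} ≤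
      ENNReal.ofReal (100 * a * b) * (ENNReal.ofReal K)⁻¹ := by
  rcases hK.eq_or_lt with rfl | hK
  · rw [ENNReal.ofReal_zero, ENNReal.inv_zero, ENNReal.mul_top]
    · exact le_top
    · have : 0 < 100 * a * b := by positivity
      simpa using this
  rcases eq_or_ne s 0 with rfl | hs
  · simp
  have hs' : 0 < |s| := abs_pos.2 hs
  have hm : 0 < max a b := lt_max_of_lt_left ha
  -- Here `|x + y + s| ≥ K/2`, which gives the constant `16/3 ≤ 6`.
  have hV := volume_interaction_le (s := s) (t := t) (δ := 6 * max a b / (|s| * K))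
    hP hQ hPb hQa (by
      intro x y τ τ' hxP hxQ hyP hyQ h1 h2
      have hx := hPQ _ hxP _ hxQ
      have hy := hPQ _ hyP _ hyQ
      simp only [Prod.mk_add_mk] at hx hy
      have hKle : K ≤ 2 * |x + y + s| := by
        -- The left side is the frequency sum bounded below by `K`; the last term is absorbed by `|x
        -- - y| ≤ |x + y + s|`.
        have e : x + (x + s) = (x + y + s) + (x - y) := by ring
        rw [e] at hx
        have := abs_add_le (x + y + s) (x - y)
        linarith
      rw [le_div_iff₀ (by positivity)]
      nlinarith [mul_le_mul_of_nonneg_left hKle (mul_nonneg hs'.le (abs_nonneg (x - y)))])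
  have hmn : 0 < min a b := lt_min ha hb
  calc _ ≤ ENNReal.ofReal |s| * (ENNReal.ofReal (4 * min a b) *
        (ENNReal.ofReal 4 * ENNReal.ofReal (6 * max a b / (|s| * K)))) := by
        gcongr
        simpa using hV
    _ = ENNReal.ofReal (|s| * (4 * min a b * (4 * (6 * max a b / (|s| * K))))) := by
        rw [← ENNReal.ofReal_mul (by norm_num), ← ENNReal.ofReal_mul (by positivity),
          ← ENNReal.ofReal_mul (by positivity)]
    _ = ENNReal.ofReal (96 * a * b * K⁻¹) := by
        congr 1
        rw [mul_assoc 96, ← min_mul_max a b]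
        field_simp
        ring
    _ ≤ _ := by
        rw [← ENNReal.ofReal_inv_of_pos hK, ← ENNReal.ofReal_mul (by positivity)]
        gcongr
        norm_num

/-! ### Functions representing a tempered distribution -/

open scoped ContDiff in
/-- A compactly supported smooth real function, as a complex Schwartz function. -/
noncomputable def testFunction (φ : ℝ × ℝ → ℝ) (h : ContDiff ℝ ∞ φ) (hc : HasCompactSupport φ) :
    𝓢(ℝ × ℝ, ℂ) :=
  HasCompactSupport.toSchwartzMap (f := fun x => (φ x : ℂ)) (hc.comp_left Complex.ofReal_zero)
    (Complex.ofRealCLM.contDiff.comp h)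

open scoped ContDiff in
theorem testFunction_apply (φ : ℝ × ℝ → ℝ) (h : ContDiff ℝ ∞ φ) (hc : HasCompactSupport φ)
    (x : ℝ × ℝ) : testFunction φ h hc x = (φ x : ℂ) := rfl

variable {F F' : ℝ × ℝ → ℂ} {f : 𝓢'(ℝ × ℝ, ℂ)}

theorem Represents.locallyIntegrable (hF : Represents F f) : LocallyIntegrable F := by
  intro x
  let φ : ContDiffBump x := ⟨1, 2, one_pos, one_lt_two⟩
  refine ⟨Metric.ball x 1, Metric.ball_mem_nhds x one_pos, ?_⟩
  have h := ((hF (testFunction φ φ.contDiff φ.hasCompactSupport)).1).integrableOn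
    (s := Metric.ball x 1)
  refine h.congr_fun (fun y hy => ?_) measurableSet_ball
  simp only [testFunction_apply]
  rw [φ.one_of_mem_closedBall (Metric.ball_subset_closedBall hy)]
  simp

/-- Makes the infimum in `hatNorm` equal to the value at any representative. -/
theorem Represents.ae_eq (hF : Represents F f) (hF' : Represents F' f) : F =ᵐ[volume] F' := by
  refine ae_eq_of_integral_contDiff_smul_eq hF.locallyIntegrable hF'.locallyIntegrable
    fun φ hφ hc => ?_
  have h1 := (hF (testFunction φ hφ hc)).2
  rw [(hF' (testFunction φ hφ hc)).2] at h1
  simpa [testFunction_apply, Complex.real_smul] using h1.symm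

/-- A function representing `f` vanishes almost everywhere off the support of `f`. -/
theorem Represents.ae_eq_zero (hF : Represents F f) :
    ∀ᵐ x, x ∉ Distribution.dsupport f → F x = 0 := by
  rw [ae_iff]
  refine measure_null_of_locally_null _ fun x hx => ?_
  simp only [Classical.not_imp, Set.mem_ofPred_eq] at hx
  obtain ⟨U, hfU, hU, hxU⟩ := (Distribution.notMem_dsupport_iff x).1 hx.1
  have h := hU.ae_eq_zero_of_integral_contDiff_smul_eq_zero
    (hF.locallyIntegrable.locallyIntegrableOn U) fun φ hφ hc hs => by
      have h0 := hfU (testFunction φ hφ hc) ((tsupport_comp_subset Complex.ofReal_zero φ).trans hs)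
      rw [(hF (testFunction φ hφ hc)).2] at h0
      simpa [testFunction_apply, Complex.real_smul] using h0
  rw [ae_iff] at h
  refine ⟨_, inter_mem_nhdsWithin _ (hU.mem_nhds hxU), measure_mono_null ?_ h⟩
  rintro y ⟨hy, hyU⟩
  simp only [Classical.not_imp, Set.mem_ofPred_eq] at hy ⊢
  exact ⟨hyU, hy.2⟩

theorem besovNorm_congr_ae {lam s b : ℝ} (h : F =ᵐ[volume] F') :
    besovNorm lam s b F = besovNorm lam s b F' := by
  have hjk : ∀ j k : ℕ,
      eLpNorm (fun p => (bracket p.1 ^ s * bracket (modulation lam p) ^ b) • F p) 2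
        (volume.restrict (A j ∩ B lam k)) =
      eLpNorm (fun p => (bracket p.1 ^ s * bracket (modulation lam p) ^ b) • F' p) 2
        (volume.restrict (A j ∩ B lam k)) := fun j k => by
    refine eLpNorm_congr_ae (ae_restrict_of_ae ?_)
    filter_upwards [h] with x hx
    rw [hx]
  simp only [besovNorm, hjk]

theorem hatNorm_eq_besovNorm {lam s b : ℝ} (hF : Represents F f) :
    hatNorm lam s b f = besovNorm lam s b F := by
  refine le_antisymm (iInf₂_le F hF) (le_iInf₂ fun F' hF' => ?_)
  rw [besovNorm_congr_ae (hF.ae_eq hF')]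

theorem hatNorm_eq_top {lam s b : ℝ} (h : ∀ F, ¬ Represents F f) : hatNorm lam s b f = ⊤ := by
  simp [hatNorm, h]

/-! ### Weighted norms, null sets and the pointwise convolution bound -/

theorem measurable_weighted (a : ℝ) (g : 𝓢(ℝ × ℝ, ℂ)) :
    Measurable fun p : ℝ × ℝ => (|p.1| ^ a) • g p := by
  have := g.continuous.measurable
  fun_prop

theorem ae_fst_ne_of_countable {S : Set ℝ} (hS : S.Countable) :
    ∀ᵐ p : ℝ × ℝ, p.1 ∉ S := by
  rw [ae_iff]
  have : {p : ℝ × ℝ | ¬p.1 ∉ S} = S ×ˢ Set.univ := by ext; simp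
  rw [this, Measure.volume_eq_prod, Measure.prod_prod, hS.measure_zero, zero_mul]

theorem ae_fst_ne_zero : ∀ᵐ p : ℝ × ℝ, p.1 ≠ 0 := by
  simpa using ae_fst_ne_of_countable (Set.countable_singleton 0)

theorem eq_zero_of_weightedL2_eq_zero {a : ℝ} {g : 𝓢(ℝ × ℝ, ℂ)} (h : weightedL2 a g = 0) :
    g = 0 := by
  rw [weightedL2, eLpNorm_eq_zero_iff (measurable_weighted a g).aestronglyMeasurable
    two_ne_zero] at h
  have h0 : (g : ℝ × ℝ → ℂ) =ᵐ[volume] fun _ => 0 := by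
    filter_upwards [h, ae_fst_ne_zero] with p hp hp0
    simpa [(Real.rpow_pos_of_pos (abs_pos.2 hp0) a).ne'] using hp
  ext p
  exact congrFun ((g.continuous.ae_eq_iff_eq volume continuous_const).1 h0) p

theorem conv_zero (f : 𝓢'(ℝ × ℝ, ℂ)) (x : ℝ × ℝ) : conv f 0 x = 0 := by
  have : reflectAt 0 x = 0 := by
    ext y; rw [reflectAt_apply]; rfl
  rw [conv, this, map_zero]

theorem enorm_conv_le (hF : Represents F f) (g : 𝓢(ℝ × ℝ, ℂ)) (x : ℝ × ℝ) :
    ‖conv f g x‖ₑ ≤ lconv (fun y => ‖F y‖ₑ) (fun y => ‖g y‖ₑ) x := by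
  rw [conv, (hF _).2]
  refine (enorm_integral_le_lintegral_enorm _).trans_eq (lintegral_congr fun y => ?_)
  rw [reflectAt_apply, enorm_mul, mul_comm]

theorem continuous_bracket : Continuous bracket := by
  unfold bracket; fun_prop

theorem countable_bracket_eq (c : ℝ) : {x | bracket x = c}.Countable := by
  refine Set.Countable.mono ?_ (Set.toFinite {√(c ^ 2 - 1), -√(c ^ 2 - 1)}).countable
  intro x hx
  have h1 : bracket x ^ 2 = 1 + x ^ 2 := Real.sq_sqrt (by positivity)
  rw [show bracket x = c from hx] at h1
  have h2 : √(c ^ 2 - 1) = |x| := by rw [h1, ← Real.sqrt_sq_eq_abs]; congr 1; ring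
  rcases abs_choice x with h | h <;> simp [h2, h]

/-- The closure adds at most points with `⟨ξ⟩ = 2^{j+1}`, which lie on finitely many vertical lines.
-/
theorem ae_mem_A_of_mem_closure (j : ℕ) : ∀ᵐ p : ℝ × ℝ, p ∈ closure (A j) → p ∈ A j := by
  have hb : Continuous fun p : ℝ × ℝ => bracket p.1 := continuous_bracket.comp continuous_fst
  have hcl : closure (A j) ⊆ {p | 2 ^ j ≤ bracket p.1 ∧ bracket p.1 ≤ 2 ^ (j + 1)} :=
    closure_minimal (fun p hp => ⟨hp.1, hp.2.le⟩)
      ((isClosed_le continuous_const hb).inter (isClosed_le hb continuous_const))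
  filter_upwards [ae_fst_ne_of_countable (countable_bracket_eq (2 ^ (j + 1)))] with p hp hpA
  exact ⟨(hcl hpA).1, lt_of_le_of_ne (hcl hpA).2 hp⟩

theorem exists_mem_B (lam : ℝ) (p : ℝ × ℝ) : ∃ k, p ∈ B lam k :=
  exists_nat_pow_near (one_le_bracket _) one_lt_two

theorem eLpNorm_two_eq (u : ℝ × ℝ → ℂ) (μ : Measure (ℝ × ℝ)) :
    eLpNorm u 2 μ = (∫⁻ x, ‖u x‖ₑ ^ 2 ∂μ) ^ (1 / 2 : ℝ) := by
  rw [eLpNorm_eq_lintegral_rpow_enorm_toReal two_ne_zero ENNReal.ofNat_ne_top]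
  simp

theorem Represents.congr_ae {F F' : ℝ × ℝ → ℂ} {f : 𝓢'(ℝ × ℝ, ℂ)} (hF : Represents F f)
    (h : F =ᵐ[volume] F') : Represents F' f := by
  intro φ
  have hφ : (fun p => φ p * F p) =ᵐ[volume] fun p => φ p * F' p := by
    filter_upwards [h] with p hp
    rw [hp]
  exact ⟨(hF φ).1.congr hφ, (hF φ).2.trans (integral_congr_ae hφ)⟩

theorem Represents.exists_stronglyMeasurable {F : ℝ × ℝ → ℂ} {f : 𝓢'(ℝ × ℝ, ℂ)}
    (hF : Represents F f) : ∃ F', StronglyMeasurable F' ∧ Represents F' f := by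
  have hm := hF.locallyIntegrable.aestronglyMeasurable
  exact ⟨hm.mk F, hm.stronglyMeasurable_mk, hF.congr_ae hm.ae_eq_mk⟩

/-- On `B lam i` the modulation bracket is at least `2^i`, and one value of `j` contributes at most
the whole `ℓ²` sum. -/
theorem tsum_le_besovNorm (lam : ℝ) (j : ℕ) (F : ℝ × ℝ → ℂ) :
    ∑' i : ℕ, ENNReal.ofReal (2 ^ i) ^ (1 / 2 : ℝ) *
        (∫⁻ x in A j ∩ B lam i, ‖F x‖ₑ ^ 2) ^ (1 / 2 : ℝ) ≤ besovNorm lam 0 (1 / 2) F := by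
  set N : ℕ → ℕ → ℝ≥0∞ := fun j i =>
    eLpNorm (fun p => (bracket p.1 ^ (0 : ℝ) * bracket (modulation lam p) ^ (1 / 2 : ℝ)) • F p) 2
      (volume.restrict (A j ∩ B lam i)) with hN
  have hterm : ∀ i, ENNReal.ofReal (2 ^ i) ^ (1 / 2 : ℝ) *
      (∫⁻ x in A j ∩ B lam i, ‖F x‖ₑ ^ 2) ^ (1 / 2 : ℝ) ≤ N j i := by
    intro i
    rw [hN, ← ENNReal.mul_rpow_of_nonneg _ _ (by norm_num)]
    simp only
    rw [eLpNorm_two_eq, ← lintegral_const_mul' _ _ ENNReal.ofReal_ne_top]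
    refine ENNReal.rpow_le_rpow (setLIntegral_mono' ((measurableSet_A j).inter
      (measurableSet_B lam i)) fun x hx => ?_) (by norm_num)
    have hb : 0 ≤ bracket (modulation lam x) := zero_le_one.trans (one_le_bracket _)
    rw [enorm_smul, mul_pow, Real.rpow_zero, one_mul, ← Real.sqrt_eq_rpow,
      Real.enorm_of_nonneg (Real.sqrt_nonneg _), ← ENNReal.ofReal_pow (Real.sqrt_nonneg _),
      Real.sq_sqrt hb]
    gcongr
    exact hx.2.1
  calc _ ≤ ∑' i, N j i := ENNReal.tsum_le_tsum hterm
    _ = ((∑' i, N j i) ^ 2) ^ (1 / 2 : ℝ) := by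
      rw [← ENNReal.rpow_natCast, ← ENNReal.rpow_mul]; norm_num
    _ ≤ _ := ENNReal.rpow_le_rpow (ENNReal.le_tsum (f := fun j => (∑' i, N j i) ^ 2) j)
      (by norm_num)

/-! ### The two bilinear estimates -/

/-- The convolution bound that follows from a bound `D 2^i` for the weighted interaction measures
of `A j ∩ B lam i` with `Q`. -/
theorem eLpNorm_conv_le {lam e : ℝ} {j : ℕ} {f : 𝓢'(ℝ × ℝ, ℂ)} {g : 𝓢(ℝ × ℝ, ℂ)}
    {Q : Set (ℝ × ℝ)} {D : ℝ≥0∞} (hD0 : D ≠ 0)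
    (hf : Distribution.dsupport f ⊆ closure (A j)) (hQ : MeasurableSet Q)
    (hD : ∀ (i : ℕ) (z : ℝ × ℝ), ENNReal.ofReal (|z.1| ^ e) ^ 2 *
      volume {y | y ∈ A j ∩ B lam i ∧ y + z ∈ Q} ≤ D * ENNReal.ofReal (2 ^ i)) :
    eLpNorm (conv f g) 2 (volume.restrict Q) ≤
      D ^ (1 / 2 : ℝ) * hatNorm lam 0 (1 / 2) f * weightedL2 (-e) g := by
  by_cases hrep : ∃ F, Represents F f
  swap
  · rw [hatNorm_eq_top (not_exists.1 hrep)]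
    -- The norm of `f` is `∞`, so the bound is trivial unless the factor from `g` vanishes. Under `∞
    -- * 0 = 0` the convolution must then be zero, and it is, since `g = 0`.
    rcases eq_or_ne (weightedL2 (-e) g) 0 with h0 | h0
    · rw [eq_zero_of_weightedL2_eq_zero h0]
      simp [eLpNorm_two_eq, conv_zero]
    · rw [ENNReal.mul_top (by simp [ENNReal.rpow_eq_zero_iff, hD0]), ENNReal.top_mul h0]
      exact le_top
  obtain ⟨F₀, hF₀⟩ := hrep
  obtain ⟨F, hFm, hF⟩ := hF₀.exists_stronglyMeasurable
  rw [hatNorm_eq_besovNorm hF]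
  have hP : ∀ i, MeasurableSet (A j ∩ B lam i) := fun i =>
    (measurableSet_A j).inter (measurableSet_B lam i)
  have key := sqrt_setLIntegral_lconv_sq_le (f := fun y => ‖F y‖ₑ) (g := fun y => ‖g y‖ₑ)
    (G := fun p => ‖(|p.1| ^ (-e)) • g p‖ₑ) (w := fun z => ENNReal.ofReal (|z.1| ^ e))
    (P := fun i => A j ∩ B lam i) (Q := Q) (D := fun i => D * ENNReal.ofReal (2 ^ i))
    hFm.measurable.enorm g.continuous.measurable.enorm (measurable_weighted _ g).enorm
    (by fun_prop) hP hQ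
    (by
      filter_upwards [hF.ae_eq_zero, ae_mem_A_of_mem_closure j] with x hx hxA
      by_cases hs : x ∈ Distribution.dsupport f
      · obtain ⟨i, hi⟩ := exists_mem_B lam x
        refine le_trans (le_of_eq ?_) (ENNReal.le_tsum i)
        rw [Set.indicator_of_mem]
        exact ⟨hxA (hf hs), hi⟩
      · simp [hx hs])
    (by
      filter_upwards [ae_fst_ne_zero] with x hx
      have hx' := abs_pos.2 hx
      rw [enorm_smul, Real.enorm_of_nonneg (by positivity), ← mul_assoc,
        ← ENNReal.ofReal_mul (by positivity), ← Real.rpow_add hx']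
      simp)
    hD
  calc eLpNorm (conv f g) 2 (volume.restrict Q)
      ≤ (∫⁻ x in Q, lconv (fun y => ‖F y‖ₑ) (fun y => ‖g y‖ₑ) x ^ 2) ^ (1 / 2 : ℝ) := by
        rw [eLpNorm_two_eq]
        gcongr
        exact enorm_conv_le hF g _
    _ ≤ _ := key
    _ ≤ _ := by
        rw [weightedL2, eLpNorm_two_eq]
        refine mul_le_mul_left ?_ _
        simp_rw [ENNReal.mul_rpow_of_nonneg _ _ (by norm_num : (0 : ℝ) ≤ 1 / 2), mul_assoc]
        rw [ENNReal.tsum_mul_left]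
        exact mul_le_mul_right (tsum_le_besovNorm lam j F) _

theorem K₁_nonneg (Ω : Set (ℝ × ℝ)) (j : ℕ) : 0 ≤ K₁ Ω j :=
  Real.sInf_nonneg (by rintro r ⟨ξ, ξ₁, τ, τ₁, -, -, rfl⟩; exact abs_nonneg _)

theorem K₁_le {Ω : Set (ℝ × ℝ)} {j : ℕ} {p q : ℝ × ℝ} (hp : p ∈ A j) (hq : q ∈ Ω) :
    K₁ Ω j ≤ |p.1 + q.1| :=
  csInf_le ⟨0, by rintro r ⟨ξ, ξ₁, τ, τ₁, -, -, rfl⟩; exact abs_nonneg _⟩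
    ⟨q.1, p.1, q.2, p.2, hq, hp, rfl⟩

theorem eLpNorm_conv_B_le {lam : ℝ} {j k : ℕ} {f : 𝓢'(ℝ × ℝ, ℂ)} {g : 𝓢(ℝ × ℝ, ℂ)}
    (hf : Distribution.dsupport f ⊆ closure (A j)) :
    eLpNorm (conv f g) 2 (volume.restrict (B lam k)) ≤
      ENNReal.ofReal (10 * (2 : ℝ) ^ ((k : ℝ) / 4)) * hatNorm lam 0 (1 / 2) f *
        weightedL2 (-1 / 4) g := by
  -- The constant 10 is the square root of the 100 in the interaction bounds.
  have hC : ENNReal.ofReal (100 * √(2 ^ k)) ^ (1 / 2 : ℝ) =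
      ENNReal.ofReal (10 * (2 : ℝ) ^ ((k : ℝ) / 4)) := by
    rw [ENNReal.ofReal_rpow_of_nonneg (by positivity) (by norm_num),
      Real.mul_rpow (by norm_num) (by positivity), Real.sqrt_eq_rpow, ← Real.rpow_natCast,
      ← Real.rpow_mul (by norm_num), ← Real.rpow_mul (by norm_num), ← Real.sqrt_eq_rpow,
      show (100 : ℝ) = 10 ^ 2 by norm_num, Real.sqrt_sq (by norm_num)]
    congr 3
    ring
  rw [← hC, show (-1 / 4 : ℝ) = -(1 / 4) by norm_num]
  refine eLpNorm_conv_le (by simp) hf (measurableSet_B lam k) fun i z => ?_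
  have h := rpow_half_mul_volume_interaction_le (lam := lam) (s := z.1) (t := z.2)
    (a := 2 ^ k) (b := 2 ^ i) (by positivity) (by positivity)
    ((measurableSet_A j).inter (measurableSet_B lam i)) (measurableSet_B lam k)
    (fun p hp => abs_modulation_lt_of_mem_B hp.2) (fun p hp => abs_modulation_lt_of_mem_B hp)
  rw [← ENNReal.ofReal_pow (by positivity), ← Real.rpow_natCast, ← Real.rpow_mul (abs_nonneg _),
    ← ENNReal.ofReal_mul (by positivity)]
  convert h using 3
  rw [Real.sqrt_eq_rpow]
  norm_num

theorem eLpNorm_conv_inter_B_le {lam : ℝ} {j k : ℕ} {f : 𝓢'(ℝ × ℝ, ℂ)} {g : 𝓢(ℝ × ℝ, ℂ)}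
    {Ω : Set (ℝ × ℝ)} (hf : Distribution.dsupport f ⊆ closure (A j))
    (hΩ : NullMeasurableSet Ω volume) :
    eLpNorm (conv f g) 2 (volume.restrict (Ω ∩ B lam k)) ≤
      ENNReal.ofReal (10 * (2 : ℝ) ^ ((k : ℝ) / 2)) * ENNReal.ofReal (K₁ Ω j) ^ (-1 / 2 : ℝ) *
        hatNorm lam 0 (1 / 2) f * weightedL2 (-1 / 2) g := by
  -- The measurable replacement is taken inside `Ω`, so that the lower bound by `K₁ Ω j` holds at
  -- each of its points.
  obtain ⟨T, hTΩ, hT, hTe⟩ := hΩ.exists_measurable_subset_ae_eq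
  rw [← Measure.restrict_congr_set (hTe.inter (ae_eq_refl (B lam k)))]
  have hC : (ENNReal.ofReal (100 * 2 ^ k) * (ENNReal.ofReal (K₁ Ω j))⁻¹) ^ (1 / 2 : ℝ) =
      ENNReal.ofReal (10 * (2 : ℝ) ^ ((k : ℝ) / 2)) *
        ENNReal.ofReal (K₁ Ω j) ^ (-1 / 2 : ℝ) := by
    rw [ENNReal.mul_rpow_of_nonneg _ _ (by norm_num),
      ENNReal.ofReal_rpow_of_nonneg (by positivity) (by norm_num),
      Real.mul_rpow (by norm_num) (by positivity), ← Real.rpow_natCast,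
      ← Real.rpow_mul (by norm_num), ← Real.sqrt_eq_rpow,
      show (100 : ℝ) = 10 ^ 2 by norm_num, Real.sqrt_sq (by norm_num), ENNReal.inv_rpow,
      ← ENNReal.rpow_neg]
    congr 4 <;> ring
  rw [← hC, show (-1 / 2 : ℝ) = -(1 / 2) by norm_num]
  refine eLpNorm_conv_le ?_ hf (hT.inter (measurableSet_B lam k)) fun i z => ?_
  · refine mul_ne_zero ?_ (ENNReal.inv_ne_zero.2 ENNReal.ofReal_ne_top)
    simp
  have h := abs_mul_volume_interaction_le (lam := lam) (s := z.1) (t := z.2)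
    (a := 2 ^ k) (b := 2 ^ i) (by positivity) (by positivity) (K₁_nonneg Ω j)
    ((measurableSet_A j).inter (measurableSet_B lam i)) (hT.inter (measurableSet_B lam k))
    (fun p hp => abs_modulation_lt_of_mem_B hp.2) (fun p hp => abs_modulation_lt_of_mem_B hp.2)
    (fun p hp q hq => K₁_le hp.1 (hTΩ hq.1))
  rw [← ENNReal.ofReal_pow (by positivity), ← Real.sqrt_eq_rpow, Real.sq_sqrt (abs_nonneg _),
    mul_right_comm, ← ENNReal.ofReal_mul (by positivity)]
  exact h

end Ostrovsky

theorem lemma2p2 :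
    ∃ C : ℝ, 0 < C ∧ ∀ lam : ℝ, 1 ≤ lam →
      ∀ (j : ℕ) (f : 𝓢'(ℝ × ℝ, ℂ)) (g : 𝓢(ℝ × ℝ, ℂ)) (Ω : Set (ℝ × ℝ)),
      Distribution.dsupport f ⊆ closure (Ostrovsky.A j) →
      NullMeasurableSet Ω volume → 0 < volume Ω →
      (∀ ξ τ ξ₁ τ₁ : ℝ, (ξ, τ) ∈ Ω → (ξ₁, τ₁) ∈ Distribution.dsupport f →
        ξ * ξ₁ < 0 ∨
          (0 ≤ ξ * ξ₁ ∧ 1 / 2 < |1 - 4 / (3 * lam ^ 4 * ξ * ξ₁ * (ξ - ξ₁) ^ 2)|)) →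
      ∀ k : ℕ,
        eLpNorm (Ostrovsky.conv f g) 2 (volume.restrict (Ostrovsky.B lam k)) ≤
          ENNReal.ofReal (C * (2 : ℝ) ^ ((k : ℝ) / 4)) *
            Ostrovsky.hatNorm lam 0 (1 / 2) f * Ostrovsky.weightedL2 (-1 / 4) g ∧
        eLpNorm (Ostrovsky.conv f g) 2 (volume.restrict (Ω ∩ Ostrovsky.B lam k)) ≤
          ENNReal.ofReal (C * (2 : ℝ) ^ ((k : ℝ) / 2)) *
            ENNReal.ofReal (Ostrovsky.K₁ Ω j) ^ (-1 / 2 : ℝ) *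
            Ostrovsky.hatNorm lam 0 (1 / 2) f * Ostrovsky.weightedL2 (-1 / 2) g := by
  exact ⟨10, by norm_num, fun lam _ j f g Ω hf hΩ _ _ k =>
    ⟨Ostrovsky.eLpNorm_conv_B_le hf, Ostrovsky.eLpNorm_conv_inter_B_le hf hΩ⟩⟩
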